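/- For integers $m\ge n\ge 1$ let $\Pi_{m,n}$ be the set of real polynomials $\phi$ of degree $m$ with $\phi(x)=e^{x}+\mathcal O(x^{n+1})$ as $x\to 0$. For $\phi\in\Pi_{m,n}$ let $$R(\phi)=\sup\{r \mid r=0,\ \text{or } r>0 \text{ and } \phi^{(k)}(x)\ge 0 \text{ for all } x\in[-r,0] \text{ and all integers } k\ge 0\},$$ and let $R_{m,n}=\sup\{R(\phi)\mid \phi\in\Pi_{m,n}\}$ be the optimal threshold factor. For $\gamma>-1$ let $L_n^{(\gamma)}(x)=\sum_{k=0}^{n}(-1)^k\binom{n+\gamma}{n-k}\frac{x^k}{k!}$ be the generalized Laguerre polynomial and, for $n\ge 1$, let $\ell_n^{(\gamma)}$ be its smallest real zero. Theorem. Let $m$ and $p$ be positive integers with $m\ge 2p-1$. Then $L_p^{(m-2p+1)}$ has a smallest real zero $\ell_p^{(m-2p+1)}$, and $$R_{m,2p-1}\ \ge\ \ell_p^{(m-2p+1)}.$$ The bound is sharp: for $p=1$ equality holds, i.e. $R_{m,1}=\ell_1^{(m-1)}$ for every $m\ge 1$. -/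

import Mathlib

open Polynomial Filter Topology Asymptotics

/-- `Π_{m,n}`: the real polynomials `φ` of degree `m` with
`φ(x) = exp x + O(x^(n+1))` as `x → 0`. -/
def orderPolys (m n : ℕ) : Set ℝ[X] :=
  {φ | φ.natDegree = m ∧
    (fun x : ℝ => φ.eval x - Real.exp x) =O[𝓝 0] fun x : ℝ => x ^ (n + 1)}

/-- The threshold factor `R(φ)`: the supremum of the `r` such that `r = 0`, or `r > 0` and `φ` is
absolutely monotonic over `[-r, 0]`. -/
noncomputable def thresholdFactor (φ : ℝ[X]) : ℝ :=
  sSup {r : ℝ | r = 0 ∨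
    (0 < r ∧ AbsolutelyMonotoneOn (fun x : ℝ => φ.eval x) (Set.Icc (-r) 0))}

/-- The optimal threshold factor `R_{m,n} = sup {R(φ) | φ ∈ Π_{m,n}}`. -/
noncomputable def optimalThresholdFactor (m n : ℕ) : ℝ :=
  sSup (thresholdFactor '' orderPolys m n)

/-- The generalized Laguerre polynomial
`L_n^(γ)(x) = ∑_{k=0}^n (-1)^k binom(n+γ, n-k) x^k / k!`, for a real parameter `γ`. -/
noncomputable def genLaguerre (n : ℕ) (γ : ℝ) : ℝ[X] :=
  ∑ k ∈ Finset.range (n + 1),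
    C ((-1) ^ k * Ring.choose ((n : ℝ) + γ) (n - k) / (k.factorial : ℝ)) * X ^ k

/-- `ℓ_n^(γ)`: the smallest real zero of `L_n^(γ)`. -/
noncomputable def laguerreMinZero (n : ℕ) (γ : ℝ) : ℝ :=
  sInf {x : ℝ | (genLaguerre n γ).IsRoot x}

/-! Put `α = m - 2p + 1` and `n = 2p - 1`, so `m = α + n`. Gauss quadrature for the weight `t ^ α *
exp (-t)` on the half-line has the `p` zeros of `L_p^(α)` as nodes `a`, positive weights `w a`, and
is exact up to degree `n`. Set `φ(x) = ∑ w a * a ^ (-α) * (x + a) ^ m / m!`. Its coefficient at `x ^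
j`, `j ≤ n`, is `binom(m, j) / m!` times the quadrature of `t ^ (n - j)`, whose exact value is `(m -
j)!`; this gives `1 / j!`. Each `x + a` is nonnegative on `[-r, 0]` once `r` is at most the smallest
node, hence so are all derivatives of `φ` (`laguerreMinZero_le_optimalThresholdFactor`). For `p = 1`
the smallest zero is `m`, and no threshold factor exceeds `m`: expanding `φ` at `-r` with
nonnegative coefficients gives `r φ'(0) ≤ m φ(0)`, where `φ(0) = φ'(0) = 1`
(`le_of_absolutelyMonotoneOn`). -/

/-- A real polynomial without positive zeros has constant sign on the positive half-line. -/
lemma Polynomial.nonneg_or_nonpos_of_no_pos_root {f : ℝ[X]} (h : ∀ x > 0, f.eval x ≠ 0) :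
    (∀ x > 0, 0 ≤ f.eval x) ∨ ∀ x > 0, f.eval x ≤ 0 := by
  by_contra! hc
  obtain ⟨⟨a, ha, hfa⟩, b, hb, hfb⟩ := hc
  have hconn : IsPreconnected (Set.Ioi (0 : ℝ)) := isPreconnected_Ioi
  obtain ⟨c, hc, hfc⟩ := hconn.intermediate_value ha hb f.continuous.continuousOn
    (show (0 : ℝ) ∈ Set.Icc _ _ from ⟨hfa.le, hfb.le⟩)
  exact h c hc hfc

/-- Every nonzero real polynomial can be multiplied by linear factors at some of its distinct
positive zeros so that the product has constant sign on the positive half-line. -/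
lemma Polynomial.exists_prod_mul_constant_sign {f : ℝ[X]} (hf : f ≠ 0) :
    ∃ S : Finset ℝ, (∀ a ∈ S, 0 < a ∧ f.IsRoot a) ∧
      ((∀ x > 0, 0 ≤ (f * ∏ a ∈ S, (X - C a)).eval x) ∨
        ∀ x > 0, (f * ∏ a ∈ S, (X - C a)).eval x ≤ 0) := by
  induction hn : f.natDegree generalizing f with
  | zero =>
    refine ⟨∅, by simp, ?_⟩
    rw [natDegree_eq_zero] at hn
    obtain ⟨c, rfl⟩ := hn
    simpa using le_total 0 c |>.imp (fun h _ _ => h) (fun h _ _ => h)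
  | succ n ih =>
    by_cases hroot : ∀ x > 0, f.eval x ≠ 0
    · exact ⟨∅, by simp, by simpa using nonneg_or_nonpos_of_no_pos_root hroot⟩
    push Not at hroot
    obtain ⟨a, ha, hfa⟩ := hroot
    obtain ⟨g, rfl⟩ := dvd_iff_isRoot.mpr hfa
    have hg : g ≠ 0 := right_ne_zero_of_mul hf
    have hgn : g.natDegree = n := by
      rw [natDegree_mul (X_sub_C_ne_zero a) hg, natDegree_X_sub_C] at hn
      omega
    obtain ⟨S, hS, hsign⟩ := ih hg hgn
    -- The factor `X - a` of `f` either replaces the one in the product, leaving it unchanged, or is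
    -- squared by inserting `a`.
    by_cases haS : a ∈ S
    · refine ⟨S.erase a, fun b hb => ?_, ?_⟩
      · have := hS b (Finset.mem_of_mem_erase hb)
        exact ⟨this.1, dvd_iff_isRoot.mp ((dvd_iff_isRoot.mpr this.2).mul_left _)⟩
      · rwa [mul_comm (X - C a), mul_assoc,
          Finset.mul_prod_erase S (fun a => X - C a) haS]
    · refine ⟨insert a S, fun b hb => ?_, ?_⟩
      · rcases Finset.mem_insert.mp hb with rfl | hb
        · exact ⟨ha, hfa⟩
        · exact ⟨(hS b hb).1, dvd_iff_isRoot.mp ((dvd_iff_isRoot.mpr (hS b hb).2).mul_left _)⟩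
      · have key : ∀ x, ((X - C a) * g * ∏ b ∈ insert a S, (X - C b)).eval x =
            (x - a) ^ 2 * (g * ∏ b ∈ S, (X - C b)).eval x := by
          intro x
          rw [Finset.prod_insert haS]
          simp only [eval_mul, eval_sub, eval_X, eval_C]
          ring
        simp only [key]
        exact hsign.imp (fun h x hx => mul_nonneg (sq_nonneg _) (h x hx))
          (fun h x hx => mul_nonpos_of_nonneg_of_nonpos (sq_nonneg _) (h x hx))

section GaussQuadrature

variable {L : ℝ[X] →ₗ[ℝ] ℝ} {P : ℝ[X]}

/-- A polynomial orthogonal to all polynomials of lower degree, with respect to a functional that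
is positive on the positive half-line, has only simple zeros, and they are all positive. -/
lemma exists_eq_C_mul_nodal_of_orthogonal
    (hpos : ∀ q : ℝ[X], q ≠ 0 → (∀ x > 0, 0 ≤ q.eval x) → 0 < L q)
    (hP : P ≠ 0) (horth : ∀ q : ℝ[X], q.degree < P.degree → L (P * q) = 0) :
    ∃ S : Finset ℝ, S.card = P.natDegree ∧ (∀ a ∈ S, 0 < a) ∧
      P = C P.leadingCoeff * Lagrange.nodal S id := by
  obtain ⟨S, hS, hsign⟩ := exists_prod_mul_constant_sign hP
  have hnodal : ∏ a ∈ S, (X - C a) = Lagrange.nodal S id := by simp [Lagrange.nodal_eq]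
  rw [hnodal] at hsign
  have hne : P * Lagrange.nodal S id ≠ 0 := mul_ne_zero hP Lagrange.nodal_ne_zero
  have hL : L (P * Lagrange.nodal S id) ≠ 0 := by
    rcases hsign with h | h
    · exact (hpos _ hne h).ne'
    · have := hpos (-(P * Lagrange.nodal S id)) (neg_ne_zero.mpr hne) fun x hx => by
        simpa using h x hx
      rw [map_neg] at this
      linarith
  -- With fewer sign-correcting factors than `deg P`, orthogonality would contradict `hL`.
  have hcard : P.natDegree ≤ S.card := by
    by_contra! hlt
    refine hL (horth _ ?_)
    rw [Lagrange.degree_nodal, degree_eq_natDegree hP]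
    exact_mod_cast hlt
  have hdvd : Lagrange.nodal S id ∣ P := by
    rw [← hnodal]
    refine Finset.prod_dvd_of_coprime (fun a _ b _ hab => ?_)
      fun a ha => dvd_iff_isRoot.mpr (hS a ha).2
    exact isCoprime_X_sub_C_of_isUnit_sub (sub_ne_zero.mpr hab).isUnit
  have hcard' : S.card ≤ P.natDegree := by
    simpa [Lagrange.natDegree_nodal] using natDegree_le_of_dvd hdvd hP
  refine ⟨S, le_antisymm hcard' hcard, fun a ha => (hS a ha).1, ?_⟩
  have := eq_leadingCoeff_mul_of_monic_of_dvd_of_natDegree_le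
    (Lagrange.nodal_monic (s := S) (v := id)) hdvd
    (by simpa [Lagrange.natDegree_nodal] using hcard)
  exact this

/-- Gauss quadrature: the functional agrees with a positive combination of the values at the
zeros of the orthogonal polynomial, up to degree `2 deg P - 1`. -/
lemma exists_gauss_quadrature
    (hpos : ∀ q : ℝ[X], q ≠ 0 → (∀ x > 0, 0 ≤ q.eval x) → 0 < L q)
    (hP : P ≠ 0) (horth : ∀ q : ℝ[X], q.degree < P.degree → L (P * q) = 0)
    {S : Finset ℝ} (hS : P = C P.leadingCoeff * Lagrange.nodal S id) :
    ∃ w : ℝ → ℝ, (∀ a ∈ S, 0 < w a) ∧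
      ∀ f : ℝ[X], f.natDegree < 2 * S.card → L f = ∑ a ∈ S, w a * f.eval a := by
  have hlc : P.leadingCoeff ≠ 0 := leadingCoeff_ne_zero.mpr hP
  have hdeg : P.degree = S.card := by
    rw [hS, degree_C_mul hlc, Lagrange.degree_nodal]
  have hinj : Set.InjOn (id : ℝ → ℝ) S := Set.injOn_id _
  have horth' : ∀ q : ℝ[X], q.degree < S.card → L (Lagrange.nodal S id * q) = 0 := by
    intro q hq
    have := horth q (hdeg ▸ hq)
    rw [hS, mul_assoc, ← smul_eq_C_mul, map_smul, smul_eq_mul] at this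
    exact (mul_eq_zero.mp this).resolve_left hlc
  have hexact : ∀ f : ℝ[X], f.natDegree < 2 * S.card →
      L f = ∑ a ∈ S, L (Lagrange.basis S id a) * f.eval a := by
    intro f hf
    have hmon : (Lagrange.nodal S (id : ℝ → ℝ)).Monic := Lagrange.nodal_monic
    set N := Lagrange.nodal S (id : ℝ → ℝ) with hN
    have hdiv : f %ₘ N + N * (f /ₘ N) = f := modByMonic_add_div f N
    -- The quotient has degree below that of `N`, so `L` kills `N` times it; the remainder is
    -- interpolated exactly at the nodes.
    have hq : (f /ₘ N).degree < S.card := by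
      refine degree_le_natDegree.trans_lt (Nat.cast_lt.mpr ?_)
      rw [natDegree_divByMonic f hmon, hN, Lagrange.natDegree_nodal]
      have : S.card ≠ 0 := by omega
      omega
    have hr : (f %ₘ N).degree < S.card := by
      have := degree_modByMonic_lt f hmon
      rwa [hN, Lagrange.degree_nodal, ← hN] at this
    have heval : ∀ a ∈ S, (f %ₘ N).eval a = f.eval a := by
      intro a ha
      conv_rhs => rw [← hdiv]
      have : N.eval a = 0 := Lagrange.eval_nodal_at_node (v := id) ha
      simp [this]
    have hLf : L f = L (f %ₘ N) := by
      conv_lhs => rw [← hdiv]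
      rw [map_add, horth' _ hq, add_zero]
    rw [hLf, Lagrange.eq_interpolate hinj hr, Lagrange.interpolate_apply, map_sum]
    refine Finset.sum_congr rfl fun a ha => ?_
    rw [← smul_eq_C_mul, map_smul, smul_eq_mul, mul_comm, id, heval a ha]
  refine ⟨fun a => L (Lagrange.basis S id a), fun a ha => ?_, hexact⟩
  set B := Lagrange.basis S (id : ℝ → ℝ) a with hB
  have hBn : B.natDegree = S.card - 1 := Lagrange.natDegree_basis hinj ha
  have hc : 0 < S.card := Finset.card_pos.mpr ⟨a, ha⟩
  -- The rule is exact on `B ^ 2`, which is `1` at `a` and `0` at the other nodes; so the weight at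
  -- `a` equals `L (B ^ 2) > 0`.
  have hB2 : (B * B).natDegree < 2 * S.card := by
    refine natDegree_mul_le.trans_lt ?_
    omega
  have hBne : B ≠ 0 := Lagrange.basis_ne_zero hinj ha
  have h1 := hexact _ hB2
  rw [Finset.sum_eq_single_of_mem a ha] at h1
  · have h2 : B.eval a = 1 := Lagrange.eval_basis_self hinj ha
    rw [eval_mul, h2, mul_one, mul_one] at h1
    show 0 < L B
    rw [← h1]
    exact hpos _ (mul_ne_zero hBne hBne) fun x _ => by
      rw [eval_mul]; exact mul_self_nonneg _
  · intro b hb hba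
    have : B.eval b = 0 := Lagrange.eval_basis_of_ne (v := id) hba.symm hb
    simp [this]

end GaussQuadrature

/-! ### Laguerre weight and orthogonality -/

/-- The moment functional `q ↦ ∫ t in (0, ∞), t ^ α * exp (-t) * q t` of the Laguerre weight. -/
noncomputable def laguerreFunctional (α : ℕ) : ℝ[X] →ₗ[ℝ] ℝ :=
  Polynomial.lsum fun k => ((α + k).factorial : ℝ) • LinearMap.id

lemma laguerreFunctional_C_mul_X_pow (α k : ℕ) (c : ℝ) :
    laguerreFunctional α (C c * X ^ k) = (α + k).factorial * c := by
  rw [laguerreFunctional, lsum_apply, C_mul_X_pow_eq_monomial, sum_monomial_index]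
  · simp
  · simp

lemma laguerreFunctional_eq_integral (α : ℕ) (q : ℝ[X]) :
    MeasureTheory.IntegrableOn (fun t => Real.exp (-t) * t ^ α * q.eval t) (Set.Ioi 0) ∧
      laguerreFunctional α q = ∫ t in Set.Ioi (0 : ℝ), Real.exp (-t) * t ^ α * q.eval t := by
  induction q using Polynomial.induction_on' with
  | add p q hp hq =>
    simp only [eval_add, mul_add, map_add]
    exact ⟨hp.1.add hq.1, by rw [MeasureTheory.integral_add hp.1 hq.1, hp.2, hq.2]⟩
  | monomial k c =>
    have hs : (0 : ℝ) < ((α + k : ℕ) : ℝ) + 1 := by positivity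
    have hfun : ∀ t : ℝ, Real.exp (-t) * t ^ α * (monomial k c).eval t =
        Real.exp (-t) * t ^ (((α + k : ℕ) : ℝ) + 1 - 1) * c := by
      intro t
      rw [add_sub_cancel_right, Real.rpow_natCast, eval_monomial, pow_add]
      ring
    simp only [hfun]
    refine ⟨(Real.GammaIntegral_convergent hs).mul_const c, ?_⟩
    rw [MeasureTheory.integral_mul_const, ← Real.Gamma_eq_integral hs,
      Real.Gamma_nat_eq_factorial, ← C_mul_X_pow_eq_monomial, laguerreFunctional_C_mul_X_pow]

/-- The integrand is nonnegative and vanishes on the half-line only at the finitely many roots of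
`q`. -/
lemma laguerreFunctional_pos (α : ℕ) {q : ℝ[X]} (hq : q ≠ 0) (hnn : ∀ x > 0, 0 ≤ q.eval x) :
    0 < laguerreFunctional α q := by
  obtain ⟨hint, heq⟩ := laguerreFunctional_eq_integral α q
  rw [heq, MeasureTheory.setIntegral_pos_iff_support_of_nonneg_ae _ hint]
  · have hsub : Set.Ioi (0 : ℝ) \ {x | q.IsRoot x} ⊆
        Function.support (fun t => Real.exp (-t) * t ^ α * q.eval t) ∩ Set.Ioi 0 := by
      rintro x ⟨hx, hr⟩
      have hx' : (0 : ℝ) < x := hx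
      exact ⟨mul_ne_zero (by positivity) hr, hx⟩
    refine lt_of_lt_of_le ?_ (MeasureTheory.measure_mono hsub)
    rw [MeasureTheory.measure_sdiff_null ((Polynomial.finite_setOfPred_isRoot hq).measure_zero _)]
    simp
  · filter_upwards [MeasureTheory.ae_restrict_mem measurableSet_Ioi] with x hx
    have hx' : (0 : ℝ) < x := hx
    have := hnn x hx
    simp only [Pi.zero_apply]
    positivity

lemma genLaguerre_natCast (n α : ℕ) :
    genLaguerre n (α : ℝ) = ∑ k ∈ Finset.range (n + 1),
      C ((-1) ^ k * ((n + α).choose (n - k) : ℝ) / (k.factorial : ℝ)) * X ^ k := by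
  simp only [genLaguerre, ← Nat.cast_add, Ring.choose_natCast]

lemma natDegree_genLaguerre (n α : ℕ) : (genLaguerre n (α : ℝ)).natDegree = n := by
  rw [genLaguerre_natCast]
  refine natDegree_eq_of_le_of_coeff_ne_zero (natDegree_sum_le_of_forall_le _ _ fun k hk =>
    (natDegree_C_mul_X_pow_le _ _).trans (Nat.lt_succ_iff.mp (Finset.mem_range.mp hk))) ?_
  simp [finsetSum_coeff, coeff_C_mul, coeff_X_pow, Nat.factorial_ne_zero]

lemma genLaguerre_ne_zero {n : ℕ} (hn : 1 ≤ n) (α : ℕ) : genLaguerre n (α : ℝ) ≠ 0 := by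
  intro h
  have := natDegree_genLaguerre n α
  rw [h, natDegree_zero] at this
  omega

/-- An alternating binomial sum of rising factorials vanishes: it is a finite difference whose
order exceeds the degree. -/
lemma sum_neg_one_pow_choose_mul_ascFactorial {n j : ℕ} (hj : j < n) (a : ℕ) :
    ∑ k ∈ Finset.range (n + 1),
      (-1 : ℝ) ^ k * (n.choose k : ℝ) * ((a + k + 1).ascFactorial j : ℝ) = 0 := by
  have hdeg : ((ascPochhammer ℝ j).comp (X + C ((a : ℝ) + 1))).natDegree < n := by
    rw [natDegree_comp, ascPochhammer_natDegree, natDegree_X_add_C, mul_one]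
    exact hj
  have h := congrFun (Polynomial.fwdDiff_iter_eq_zero_of_degree_lt hdeg) 0
  rw [fwdDiff_iter_eq_sum_shift, Pi.zero_apply] at h
  -- The iterated difference carries the sign `(-1) ^ (n - k)`; the factor `(-1) ^ n` turns it into
  -- `(-1) ^ k`.
  have h2 : ∀ k ∈ Finset.range (n + 1),
      (-1 : ℝ) ^ k * (n.choose k : ℝ) * ((a + k + 1).ascFactorial j : ℝ) =
      (-1) ^ n * (((-1 : ℤ) ^ (n - k) * (n.choose k : ℤ)) •
        ((ascPochhammer ℝ j).comp (X + C ((a : ℝ) + 1))).eval (0 + k • (1 : ℝ))) := by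
    intro k hk
    have hkn : k ≤ n := Nat.lt_succ_iff.mp (Finset.mem_range.mp hk)
    have hev : ((ascPochhammer ℝ j).comp (X + C ((a : ℝ) + 1))).eval (0 + k • (1 : ℝ)) =
        ((a + k + 1).ascFactorial j : ℝ) := by
      rw [← ascPochhammer_nat_eq_ascFactorial, ascPochhammer_eval_cast]
      simp only [eval_comp, eval_add, eval_X, eval_C, nsmul_eq_mul, mul_one, zero_add]
      congr 1
      push_cast
      ring
    have hsign : (-1 : ℝ) ^ n * (-1) ^ (n - k) = (-1) ^ k := by
      obtain ⟨d, rfl⟩ := Nat.exists_eq_add_of_le hkn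
      rw [Nat.add_sub_cancel_left, pow_add, mul_assoc, ← mul_pow]
      norm_num
    rw [hev, zsmul_eq_mul, ← hsign]
    push_cast
    ring
  rw [Finset.sum_congr rfl h2, ← Finset.mul_sum, h, mul_zero]

/-- The moment `(α + k + j)!` is `(α + k)!` times a rising factorial of degree `j` in `k`; after
cancellation an `n`-th finite difference remains. -/
lemma laguerreFunctional_genLaguerre_mul_X_pow {n j : ℕ} (hj : j < n) (α : ℕ) :
    laguerreFunctional α (genLaguerre n (α : ℝ) * X ^ j) = 0 := by
  rw [genLaguerre_natCast, Finset.sum_mul, map_sum]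
  have h : ∀ k ∈ Finset.range (n + 1),
      laguerreFunctional α
        (C ((-1) ^ k * ((n + α).choose (n - k) : ℝ) / (k.factorial : ℝ)) * X ^ k * X ^ j) =
      ((n + α).factorial / n.factorial : ℝ) *
        ((-1 : ℝ) ^ k * (n.choose k : ℝ) * ((α + k + 1).ascFactorial j : ℝ)) := by
    intro k hk
    have hkn : k ≤ n := Nat.lt_succ_iff.mp (Finset.mem_range.mp hk)
    rw [mul_assoc, ← pow_add, laguerreFunctional_C_mul_X_pow, ← add_assoc,
      ← Nat.factorial_mul_ascFactorial (α + k) j, Nat.cast_choose ℝ hkn,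
      Nat.cast_choose ℝ (show n - k ≤ n + α by omega), show n + α - (n - k) = α + k by omega]
    have h1 : ((α + k).factorial : ℝ) ≠ 0 := by exact_mod_cast Nat.factorial_ne_zero _
    have h2 : (k.factorial : ℝ) ≠ 0 := by exact_mod_cast Nat.factorial_ne_zero _
    have h3 : ((n - k).factorial : ℝ) ≠ 0 := by exact_mod_cast Nat.factorial_ne_zero _
    have h4 : (n.factorial : ℝ) ≠ 0 := by exact_mod_cast Nat.factorial_ne_zero _
    push_cast
    field_simp
  rw [Finset.sum_congr rfl h, ← Finset.mul_sum, sum_neg_one_pow_choose_mul_ascFactorial hj, mul_zero]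

lemma laguerreFunctional_genLaguerre_mul (n α : ℕ) {q : ℝ[X]}
    (hq : q.degree < (genLaguerre n (α : ℝ)).degree) :
    laguerreFunctional α (genLaguerre n (α : ℝ) * q) = 0 := by
  have hq' : q.degree < n := by
    refine hq.trans_le (degree_le_natDegree.trans ?_)
    rw [natDegree_genLaguerre]
  rw [q.as_sum_support_C_mul_X_pow, Finset.mul_sum, map_sum]
  refine Finset.sum_eq_zero fun j hj => ?_
  have hjn : j < n := by exact_mod_cast (le_degree_of_mem_supp j hj).trans_lt hq'
  rw [mul_left_comm, ← smul_eq_C_mul, map_smul, laguerreFunctional_genLaguerre_mul_X_pow hjn,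
    smul_zero]

/-! ### Absolute monotonicity and the upper bound `m` -/

lemma Polynomial.iteratedDeriv_eval (f : ℝ[X]) (k : ℕ) :
    iteratedDeriv k (fun x => f.eval x) = fun x => (derivative^[k] f).eval x := by
  induction k generalizing f with
  | zero => simp
  | succ k ih =>
    have : deriv (fun x => f.eval x) = fun x => f.derivative.eval x := by
      ext x; exact f.deriv
    rw [iteratedDeriv_succ', this, ih, Function.iterate_succ_apply]

lemma absolutelyMonotoneOn_eval_iff {f : ℝ[X]} {r : ℝ} (hr : 0 < r) :
    AbsolutelyMonotoneOn (fun x : ℝ => f.eval x) (Set.Icc (-r) 0) ↔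
      ∀ k : ℕ, ∀ x ∈ Set.Icc (-r) 0, 0 ≤ (derivative^[k] f).eval x := by
  have hcd : ∀ n : WithTop ℕ∞, ContDiff ℝ n fun x : ℝ => f.eval x := fun n => by
    simpa using f.contDiff_aeval (𝕜 := ℝ) n
  constructor
  · intro h k x hx
    have hu : UniqueDiffOn ℝ (Set.Icc (-r) 0) := uniqueDiffOn_Icc (by linarith)
    have := h.iteratedDerivWithin_nonneg hu k hx
    rwa [iteratedDerivWithin_eq_iteratedDeriv hu (hcd _).contDiffAt hx, iteratedDeriv_eval] at this
  · intro h
    refine AbsolutelyMonotoneOn.of_contDiff (hcd _) fun k x hx => ?_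
    rw [iteratedDeriv_eval]
    exact h k x hx

/-- For a polynomial with nonnegative coefficients, `r f'(r) ≤ (deg f) f(r)`. -/
lemma Polynomial.mul_eval_derivative_le {f : ℝ[X]} (hf : ∀ k, 0 ≤ f.coeff k) {r : ℝ} (hr : 0 ≤ r) :
    r * f.derivative.eval r ≤ f.natDegree * f.eval r := by
  have h : r * f.derivative.eval r =
      ∑ k ∈ Finset.range (f.natDegree + 1), (k : ℝ) * (f.coeff k * r ^ k) := by
    rw [derivative_eval, sum_over_range _ (by simp), Finset.mul_sum]
    refine Finset.sum_congr rfl fun k _ => ?_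
    cases k with
    | zero => simp
    | succ k => rw [Nat.add_sub_cancel, pow_succ]; ring
  rw [h, eval_eq_sum_range, Finset.mul_sum]
  refine Finset.sum_le_sum fun k hk => ?_
  have hk' : (k : ℝ) ≤ f.natDegree := by
    exact_mod_cast Nat.lt_succ_iff.mp (Finset.mem_range.mp hk)
  exact mul_le_mul_of_nonneg_right hk' (mul_nonneg (hf k) (pow_nonneg hr k))

lemma eval_zero_of_mem_orderPolys {m n : ℕ} (hn : 1 ≤ n) {f : ℝ[X]} (hf : f ∈ orderPolys m n) :
    f.eval 0 = 1 ∧ f.derivative.eval 0 = 1 := by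
  have hO : (fun x : ℝ => f.eval x - Real.exp x) =O[𝓝 0] fun x : ℝ => ‖x - 0‖ ^ (n + 1) := by
    simpa only [sub_zero, norm_pow] using hf.2.norm_right
  constructor
  · have := hO.eq_zero_of_norm_pow n.succ_ne_zero
    rw [Real.exp_zero] at this
    linarith
  · have h1 := (hO.hasFDerivAt (𝕜 := ℝ) (by omega)).hasDerivAt
    have h2 := (f.hasDerivAt 0).sub (Real.hasDerivAt_exp 0)
    have := h1.unique h2
    rw [Real.exp_zero] at this
    simp at this
    linarith

lemma le_of_absolutelyMonotoneOn {m n : ℕ} (hn : 1 ≤ n) {f : ℝ[X]} (hf : f ∈ orderPolys m n)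
    {r : ℝ} (hr : 0 < r)
    (h : AbsolutelyMonotoneOn (fun x : ℝ => f.eval x) (Set.Icc (-r) 0)) : r ≤ m := by
  rw [absolutelyMonotoneOn_eval_iff hr] at h
  obtain ⟨h0, h1⟩ := eval_zero_of_mem_orderPolys hn hf
  -- `k!` times this Taylor coefficient is the `k`-th derivative at `-r`.
  have hcoeff : ∀ k, 0 ≤ (taylor (-r) f).coeff k := by
    intro k
    have hk := h k (-r) ⟨le_rfl, by linarith⟩
    rw [← factorial_smul_hasseDeriv, LinearMap.smul_apply, nsmul_eq_mul, eval_mul,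
      eval_natCast] at hk
    rw [taylor_coeff]
    exact nonneg_of_mul_nonneg_right hk (by exact_mod_cast k.factorial_pos)
  have key := mul_eval_derivative_le hcoeff hr.le
  have hd : (taylor (-r) f).derivative.eval r = 1 := by
    rw [taylor_apply, derivative_comp]
    simp [eval_comp, h1]
  rw [hd, taylor_eval, add_neg_cancel, h0, natDegree_taylor, hf.1] at key
  linarith

lemma thresholdFactor_le {m n : ℕ} (hn : 1 ≤ n) {f : ℝ[X]} (hf : f ∈ orderPolys m n) :
    thresholdFactor f ≤ m := by
  refine csSup_le ⟨0, Or.inl rfl⟩ ?_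
  rintro r (rfl | ⟨hr, h⟩)
  · positivity
  · exact le_of_absolutelyMonotoneOn hn hf hr h

lemma le_thresholdFactor {m n : ℕ} (hn : 1 ≤ n) {f : ℝ[X]} (hf : f ∈ orderPolys m n)
    {r : ℝ} (hr : 0 < r)
    (h : AbsolutelyMonotoneOn (fun x : ℝ => f.eval x) (Set.Icc (-r) 0)) :
    r ≤ thresholdFactor f := by
  -- The bound `m` is needed here too: a real `sSup` only dominates its elements when the set is
  -- bounded above.
  refine le_csSup ⟨m, ?_⟩ (Or.inr ⟨hr, h⟩)
  rintro s (rfl | ⟨hs, hs'⟩)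
  · positivity
  · exact le_of_absolutelyMonotoneOn hn hf hs hs'

lemma thresholdFactor_le_optimalThresholdFactor {m n : ℕ} (hn : 1 ≤ n) {f : ℝ[X]}
    (hf : f ∈ orderPolys m n) : thresholdFactor f ≤ optimalThresholdFactor m n := by
  refine le_csSup ⟨m, ?_⟩ ⟨f, hf, rfl⟩
  rintro _ ⟨g, hg, rfl⟩
  exact thresholdFactor_le hn hg

lemma optimalThresholdFactor_le {m n : ℕ} (hn : 1 ≤ n) : optimalThresholdFactor m n ≤ m := by
  -- Covers an empty `orderPolys m n` as well, where the supremum is `0`.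
  refine Real.sSup_le ?_ (by positivity)
  rintro _ ⟨g, hg, rfl⟩
  exact thresholdFactor_le hn hg

/-! ### The polynomial built from the quadrature rule -/

/-- A polynomial whose low coefficients are those of the exponential series approximates `exp`. -/
lemma eval_sub_exp_isBigO {f : ℝ[X]} {n : ℕ}
    (h : ∀ j < n, f.coeff j = 1 / (j.factorial : ℝ)) :
    (fun x : ℝ => f.eval x - Real.exp x) =O[𝓝 0] fun x : ℝ => x ^ n := by
  set T : ℝ[X] := ∑ i ∈ Finset.range n, C (1 / (i.factorial : ℝ)) * X ^ i with hT
  have hdvd : X ^ n ∣ f - T := by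
    rw [X_pow_dvd_iff]
    intro d hd
    rw [coeff_sub, h d hd, hT, finsetSum_coeff]
    simp [coeff_C_mul, coeff_X_pow, hd]
  obtain ⟨g, hg⟩ := hdvd
  have h1 : (fun x : ℝ => f.eval x - T.eval x) =O[𝓝 0] fun x : ℝ => x ^ n := by
    have : (fun x : ℝ => f.eval x - T.eval x) = fun x => x ^ n * g.eval x := by
      ext x
      rw [← eval_sub, hg]
      simp
    rw [this]
    have hb : (fun x : ℝ => g.eval x) =O[𝓝 0] fun _ => (1 : ℝ) :=
      g.continuous.continuousAt.isBigO_one ℝ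
    simpa using (isBigO_refl (fun x : ℝ => x ^ n) (𝓝 0)).mul hb
  have h2 := Real.exp_sub_sum_range_isBigO_pow n
  refine (h1.sub h2).congr_left fun x => ?_
  have : T.eval x = ∑ i ∈ Finset.range n, x ^ i / (i.factorial : ℝ) := by
    rw [hT, eval_finsetSum]
    refine Finset.sum_congr rfl fun i _ => ?_
    simp only [eval_mul, eval_C, eval_pow, eval_X]
    ring
  rw [this]
  ring

/-- The polynomial `∑ a ∈ S, w a * a ^ (-α) * (X + a) ^ m / m!`, obtained by applying a quadrature
rule for the Laguerre weight of exponent `α` to `t ^ (m - α) * (1 + X / t) ^ m / m!`. -/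
noncomputable def quadratureExp (m α : ℕ) (S : Finset ℝ) (w : ℝ → ℝ) : ℝ[X] :=
  ∑ a ∈ S, C (w a / a ^ α / m.factorial) * (X + C a) ^ m

section quadratureExp

variable {m α : ℕ} {S : Finset ℝ} {w : ℝ → ℝ}

lemma coeff_quadratureExp (j : ℕ) :
    (quadratureExp m α S w).coeff j =
      ∑ a ∈ S, w a / a ^ α / m.factorial * (a ^ (m - j) * (m.choose j : ℝ)) := by
  simp [quadratureExp, finsetSum_coeff, coeff_C_mul, coeff_X_add_C_pow]

lemma natDegree_quadratureExp (hS : S.Nonempty) (hSpos : ∀ a ∈ S, 0 < a)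
    (hw : ∀ a ∈ S, 0 < w a) : (quadratureExp m α S w).natDegree = m := by
  refine natDegree_eq_of_le_of_coeff_ne_zero
    (natDegree_sum_le_of_forall_le _ _ fun a _ => ?_) ?_
  · refine (natDegree_C_mul_le _ _).trans ?_
    rw [natDegree_pow, natDegree_X_add_C, mul_one]
  · rw [coeff_quadratureExp]
    refine (Finset.sum_pos (fun a ha => ?_) hS).ne'
    have h1 := hSpos a ha
    have h2 := hw a ha
    simp only [Nat.sub_self, Nat.choose_self]
    positivity

lemma coeff_quadratureExp_of_exact {n : ℕ} (hm : α + n = m) (hSpos : ∀ a ∈ S, 0 < a)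
    (hquad : ∀ f : ℝ[X], f.natDegree ≤ n →
      laguerreFunctional α f = ∑ a ∈ S, w a * f.eval a) {j : ℕ} (hj : j ≤ n) :
    (quadratureExp m α S w).coeff j = 1 / (j.factorial : ℝ) := by
  have h := hquad (C 1 * X ^ (n - j))
    ((natDegree_C_mul_X_pow_le _ _).trans (Nat.sub_le _ _))
  rw [laguerreFunctional_C_mul_X_pow, show α + (n - j) = m - j by omega] at h
  have hjm : j ≤ m := by omega
  have hterm : ∀ a ∈ S, w a / a ^ α / m.factorial * (a ^ (m - j) * (m.choose j : ℝ)) =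
      (m.choose j : ℝ) / m.factorial * (w a * (C 1 * X ^ (n - j) : ℝ[X]).eval a) := by
    intro a ha
    have ha' := (hSpos a ha).ne'
    rw [show m - j = α + (n - j) by omega, pow_add]
    simp only [eval_mul, eval_C, eval_pow, eval_X]
    field_simp
  rw [coeff_quadratureExp, Finset.sum_congr rfl hterm, ← Finset.mul_sum, ← h,
    Nat.cast_choose ℝ hjm]
  have h1 : (m.factorial : ℝ) ≠ 0 := by exact_mod_cast Nat.factorial_ne_zero _
  have h2 : ((m - j).factorial : ℝ) ≠ 0 := by exact_mod_cast Nat.factorial_ne_zero _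
  field_simp

lemma iterate_derivative_quadratureExp_nonneg {r : ℝ} (hr : 0 ≤ r) (hrS : ∀ a ∈ S, r ≤ a)
    (hw : ∀ a ∈ S, 0 < w a) (k : ℕ) {x : ℝ} (hx : x ∈ Set.Icc (-r) 0) :
    0 ≤ (derivative^[k] (quadratureExp m α S w)).eval x := by
  rw [quadratureExp, iterate_derivative_sum, eval_finsetSum]
  refine Finset.sum_nonneg fun a ha => ?_
  rw [iterate_derivative_C_mul, iterate_derivative_X_add_pow]
  have h1 : 0 ≤ a := hr.trans (hrS a ha)
  have h2 := hw a ha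
  have h3 : 0 ≤ x + a := by linarith [hrS a ha, hx.1]
  simp only [eval_mul, eval_C, nsmul_eq_mul, eval_natCast, eval_pow, eval_add, eval_X]
  positivity

end quadratureExp

/-! ### Laguerre zeros and the theorem -/

/-- The zeros of the generalized Laguerre polynomial of degree `n` form a set of `n` positive
reals, and are the nodes of a Gauss quadrature rule. -/
lemma exists_laguerre_quadrature {n : ℕ} (hn : 1 ≤ n) (α : ℕ) :
    ∃ (S : Finset ℝ) (w : ℝ → ℝ), S.Nonempty ∧ (∀ a ∈ S, 0 < a) ∧ (∀ a ∈ S, 0 < w a) ∧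
      {x : ℝ | (genLaguerre n (α : ℝ)).IsRoot x} = S ∧
      ∀ f : ℝ[X], f.natDegree ≤ 2 * n - 1 →
        laguerreFunctional α f = ∑ a ∈ S, w a * f.eval a := by
  have hne := genLaguerre_ne_zero hn α
  have hpos : ∀ q : ℝ[X], q ≠ 0 → (∀ x > 0, 0 ≤ q.eval x) → 0 < laguerreFunctional α q :=
    fun q => laguerreFunctional_pos α
  have horth : ∀ q : ℝ[X], q.degree < (genLaguerre n (α : ℝ)).degree →
      laguerreFunctional α (genLaguerre n (α : ℝ) * q) = 0 :=
    fun q => laguerreFunctional_genLaguerre_mul n α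
  obtain ⟨S, hcard, hSpos, hS⟩ := exists_eq_C_mul_nodal_of_orthogonal hpos hne horth
  obtain ⟨w, hw, hquad⟩ := exists_gauss_quadrature hpos hne horth hS
  rw [natDegree_genLaguerre] at hcard
  refine ⟨S, w, Finset.card_pos.mp (by omega), hSpos, hw, ?_, fun f hf => hquad f (by omega)⟩
  ext x
  rw [Set.mem_ofPred_eq, hS, IsRoot.def, eval_mul, eval_C, Lagrange.eval_nodal, mul_eq_zero,
    or_iff_right (leadingCoeff_ne_zero.mpr hne), Finset.prod_eq_zero_iff]
  simp only [id, sub_eq_zero, Finset.mem_coe]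
  exact ⟨fun ⟨a, ha, h⟩ => h ▸ ha, fun h => ⟨x, h, rfl⟩⟩

lemma isLeast_laguerreMinZero {n : ℕ} (hn : 1 ≤ n) (α : ℕ) :
    IsLeast {x : ℝ | (genLaguerre n (α : ℝ)).IsRoot x} (laguerreMinZero n (α : ℝ)) := by
  obtain ⟨S, w, hne, -, -, hroots, -⟩ := exists_laguerre_quadrature hn α
  rw [laguerreMinZero, hroots]
  have hfin : (S : Set ℝ).Finite := S.finite_toSet
  exact ⟨Set.Nonempty.csInf_mem hne hfin, fun x hx => csInf_le hfin.bddBelow hx⟩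

lemma laguerreMinZero_le_optimalThresholdFactor {n : ℕ} (hn : 1 ≤ n) (α : ℕ) :
    laguerreMinZero n (α : ℝ) ≤ optimalThresholdFactor (α + (2 * n - 1)) (2 * n - 1) := by
  have hleast := isLeast_laguerreMinZero hn α
  obtain ⟨S, w, hne, hSpos, hw, hroots, hquad⟩ := exists_laguerre_quadrature hn α
  rw [hroots] at hleast
  have hpos : 0 < laguerreMinZero n (α : ℝ) := hSpos _ hleast.1
  have hmem : quadratureExp (α + (2 * n - 1)) α S w ∈
      orderPolys (α + (2 * n - 1)) (2 * n - 1) :=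
    ⟨natDegree_quadratureExp hne hSpos hw, eval_sub_exp_isBigO fun j hj =>
      coeff_quadratureExp_of_exact rfl hSpos hquad (Nat.lt_succ_iff.mp hj)⟩
  have hn' : 1 ≤ 2 * n - 1 := by omega
  refine (le_thresholdFactor hn' hmem hpos ?_).trans
    (thresholdFactor_le_optimalThresholdFactor hn' hmem)
  rw [absolutelyMonotoneOn_eval_iff hpos]
  exact fun k x hx => iterate_derivative_quadratureExp_nonneg hpos.le (fun a ha => hleast.2 ha) hw k hx

lemma laguerreMinZero_one (α : ℕ) : laguerreMinZero 1 (α : ℝ) = α + 1 := by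
  have h := (isLeast_laguerreMinZero le_rfl α).1
  rw [Set.mem_ofPred_eq, genLaguerre_natCast, IsRoot.def] at h
  simp [Finset.sum_range_succ] at h
  linarith

theorem theorem2 (m p : ℕ) (hp : 1 ≤ p) (hm : 2 * p - 1 ≤ m) :
    IsLeast {x : ℝ | (genLaguerre p ((m : ℝ) - 2 * (p : ℝ) + 1)).IsRoot x}
        (laguerreMinZero p ((m : ℝ) - 2 * (p : ℝ) + 1)) ∧
      laguerreMinZero p ((m : ℝ) - 2 * (p : ℝ) + 1) ≤ optimalThresholdFactor m (2 * p - 1) ∧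
      (p = 1 →
        optimalThresholdFactor m (2 * p - 1) =
          laguerreMinZero p ((m : ℝ) - 2 * (p : ℝ) + 1)) := by
  -- The hypothesis `hm` makes the Laguerre parameter a natural number, so the moments are
  -- factorials.
  obtain ⟨α, rfl⟩ : ∃ α, m = α + (2 * p - 1) := ⟨m - (2 * p - 1), by omega⟩
  have hcast : ((α + (2 * p - 1) : ℕ) : ℝ) - 2 * (p : ℝ) + 1 = (α : ℝ) := by
    rw [Nat.cast_add, Nat.cast_sub (by omega)]
    push_cast
    ring
  rw [hcast]
  refine ⟨isLeast_laguerreMinZero hp α, laguerreMinZero_le_optimalThresholdFactor hp α, ?_⟩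
  rintro rfl
  refine le_antisymm ?_ (laguerreMinZero_le_optimalThresholdFactor le_rfl α)
  rw [laguerreMinZero_one]
  simpa using optimalThresholdFactor_le (m := α + 1) (n := 1) le_rfl
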